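/- Let $\mathbb{R}_+=[0,\infty)$ and $\mathbb{R}_{++}=(0,\infty)$. Let $\alpha,\varepsilon_1,\varepsilon_2\in\mathbb{R}$ with $\alpha\neq 1$ and $\varepsilon_1,\varepsilon_2\ge 0$, and let $f:\mathbb{R}_+^3\to\mathbb{R}$ be a function such that $$\left|f(x,y,z)-f(x,y+z,0)-(y+z)^{\alpha}f\left(0,\tfrac{y}{y+z},\tfrac{z}{y+z}\right)\right|\le\varepsilon_1\qquad(x,y,z\in\mathbb{R}_{++})$$ and $$\left|f(x_1,x_2,x_3)-f(x_{\sigma(1)},x_{\sigma(2)},x_{\sigma(3)})\right|\le\varepsilon_2$$ for all $(x_1,x_2,x_3)\in\mathbb{R}_+^3$ and all permutations $\sigma$ of $\{1,2,3\}$. Then the following hold. 1. If $\alpha<0$, there exist $a\in\mathbb{R}$ and a function $\varphi_1:\mathbb{R}_{++}\to\mathbb{R}$ such that $$\left|f(x,y,z)-\left[ax^{\alpha}+ay^{\alpha}+az^{\alpha}+\varphi_1(x+y+z)\right]\right|\le 2\varepsilon_1+3\varepsilon_2\qquad(x,y,z\in\mathbb{R}_{++}).$$ 2. If $\alpha=0$,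 there exists a function $\varphi_2:\mathbb{R}_{++}\to\mathbb{R}$ such that $$\left|f(x,y,z)-\varphi_2(x+y+z)\right|\le 191\varepsilon_1+1263\varepsilon_2\qquad(x,y,z\in\mathbb{R}_{++}).$$ 3. If $\alpha>0$ (and $\alpha\ne1$), there exists $a\in\mathbb{R}$ such that for every positive integer $n$ there is a function $\psi_n:(0,3n]\to\mathbb{R}$ with $$\left|f(x,y,z)-\left[ax^{\alpha}+ay^{\alpha}+az^{\alpha}+\psi_n(x+y+z)\right]\right|\le c_n(\alpha)\varepsilon_1+d_n(\alpha)\varepsilon_2\qquad(x,y,z\in(0,n]),$$ where $$c_n(\alpha)=2+7\cdot2^{\alpha}n^{\alpha}K(\alpha),\qquad d_n(\alpha)=4+7\cdot2^{\alpha+2}n^{\alpha}K(\alpha),$$ $$K(\alpha)=\left|2^{1-\alpha}-1\right|^{-1}\left(3+12\cdot2^{\alpha}+\frac{32\cdot3^{\alpha+1}}{\left|2^{-\alpha}-1\right|}\right).$$ -/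

import Mathlib

namespace ModifiedEntropy

/-- The constant `K(α)`; both denominators are nonzero when `α ≠ 1` and `α ≠ 0`. -/
noncomputable def K (α : ℝ) : ℝ :=
  |(2 : ℝ) ^ (1 - α) - 1|⁻¹ *
    (3 + 12 * (2 : ℝ) ^ α + 32 * (3 : ℝ) ^ (α + 1) / |(2 : ℝ) ^ (-α) - 1|)

/-- The constant `c_n(α)`. -/
noncomputable def c (n : ℕ) (α : ℝ) : ℝ :=
  2 + 7 * (2 : ℝ) ^ α * (n : ℝ) ^ α * K α

/-- The constant `d_n(α)`. -/
noncomputable def d (n : ℕ) (α : ℝ) : ℝ :=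
  4 + 7 * (2 : ℝ) ^ (α + 2) * (n : ℝ) ^ α * K α

/-- `f` satisfies the modified entropy equation with `μ(t) = t ^ α` on the positive reals up to
the error `ε`. Only the values of `f` at points with nonnegative coordinates occur. -/
def ApproxModifiedEntropy (α ε : ℝ) (f : (Fin 3 → ℝ) → ℝ) : Prop :=
  ∀ x y z : ℝ, 0 < x → 0 < y → 0 < z →
    |f ![x, y, z] - f ![x, y + z, 0] - (y + z) ^ α * f ![0, y / (y + z), z / (y + z)]| ≤ ε

/-- `f` is symmetric, up to the error `ε`, on the triples of nonnegative reals. -/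
def ApproxSymmetric (ε : ℝ) (f : (Fin 3 → ℝ) → ℝ) : Prop :=
  ∀ v : Fin 3 → ℝ, (∀ i, 0 ≤ v i) → ∀ σ : Equiv.Perm (Fin 3), |f v - f (v ∘ σ)| ≤ ε

end ModifiedEntropy

namespace ModifiedEntropy

/-! Write G for `edgeExt α f`. Evaluating `f` in different orders makes G an approximate symmetric
cocycle, and three cocycle instances show that (2^α - 2) G(x,y) + G(1,1)(x^α + y^α - (x+y)^α) is
bounded (`abs_doubling_le`). This expression is homogeneous of degree α: if α ≠ 0, rescaling forces
it to vanish, so G is exactly a coboundary; if α = 0, G is uniformly near a constant. Subtracting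
the power sum from `f` then leaves a function E that nearly depends only on one coordinate and the
total, and approximate symmetry removes the coordinate (`exists_abs_sub_le_of_edgeExt`). -/

/-- The degree `α` homogeneous extension of the restriction of `f` to the edge
`{(0, s, 1 - s)}`. -/
noncomputable def edgeExt (α : ℝ) (f : (Fin 3 → ℝ) → ℝ) (y z : ℝ) : ℝ :=
  (y + z) ^ α * f ![0, y / (y + z), z / (y + z)]

/-- A set of reals of diameter at most `2 * M` lies within `M` of some point. -/
theorem exists_center_of_sub_le {S : Set ℝ} {M : ℝ}
    (h : ∀ a ∈ S, ∀ b ∈ S, a - b ≤ 2 * M) : ∃ m : ℝ, ∀ a ∈ S, |a - m| ≤ M := by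
  refine ⟨sSup S - M, fun a ha => ?_⟩
  have hle : ∀ b ∈ S, b ≤ a + 2 * M := fun b hb => by linarith [h b hb a ha]
  have h1 : a ≤ sSup S := le_csSup ⟨a + 2 * M, hle⟩ ha
  have h2 : sSup S ≤ a + 2 * M := csSup_le ⟨a, ha⟩ hle
  exact abs_le.2 ⟨by linarith, by linarith⟩

/-- A real number all of whose multiples by `s ^ α`, `s > 0`, are bounded vanishes if `α ≠ 0`. -/
theorem eq_zero_of_forall_abs_rpow_mul_le {α C D : ℝ} (hα : α ≠ 0)
    (h : ∀ s : ℝ, 0 < s → |s ^ α * D| ≤ C) : D = 0 := by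
  by_contra hD
  have hD' : 0 < |D| := abs_pos.2 hD
  have hC : 0 ≤ C := (abs_nonneg _).trans (h 1 one_pos)
  have hu : 0 < (C + 1) / |D| := by positivity
  -- This `s` makes `|s ^ α * D|` equal to `C + 1`, whatever the sign of `α`.
  have hs := h (((C + 1) / |D|) ^ α⁻¹) (by positivity)
  rw [← Real.rpow_mul hu.le, inv_mul_cancel₀ hα, Real.rpow_one, abs_mul, abs_of_pos hu,
    div_mul_cancel₀ _ hD'.ne'] at hs
  linarith

theorem edgeExt_mul (α : ℝ) (f : (Fin 3 → ℝ) → ℝ) {s y z : ℝ} (hs : 0 < s) (hy : 0 < y)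
    (hz : 0 < z) : edgeExt α f (s * y) (s * z) = s ^ α * edgeExt α f y z := by
  unfold edgeExt
  rw [← mul_add, Real.mul_rpow hs.le (by positivity), mul_div_mul_left _ _ hs.ne',
    mul_div_mul_left _ _ hs.ne', mul_assoc]

theorem edgeExt_self (α : ℝ) (f : (Fin 3 → ℝ) → ℝ) {x : ℝ} (hx : 0 < x) :
    edgeExt α f x x = x ^ α * edgeExt α f 1 1 := by
  simpa using edgeExt_mul α f hx one_pos one_pos

theorem K_nonneg (α : ℝ) : 0 ≤ K α := by
  unfold K; positivity

theorem two_le_c (n : ℕ) (α : ℝ) : 2 ≤ c n α := by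
  have := K_nonneg α
  unfold c
  have : 0 ≤ 7 * (2 : ℝ) ^ α * (n : ℝ) ^ α * K α := by positivity
  linarith

theorem four_le_d (n : ℕ) (α : ℝ) : 4 ≤ d n α := by
  have := K_nonneg α
  unfold d
  have : 0 ≤ 7 * (2 : ℝ) ^ (α + 2) * (n : ℝ) ^ α * K α := by positivity
  linarith

section

variable {α ε₁ ε₂ : ℝ} {f : (Fin 3 → ℝ) → ℝ}

theorem ApproxSymmetric.swap_fst_snd (hsymm : ApproxSymmetric ε₂ f) {x y z : ℝ} (hx : 0 ≤ x)
    (hy : 0 ≤ y) (hz : 0 ≤ z) : |f ![x, y, z] - f ![y, x, z]| ≤ ε₂ := by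
  have h := hsymm ![x, y, z] (by intro i; fin_cases i <;> simpa) (Equiv.swap 0 1)
  have e : ![x, y, z] ∘ (Equiv.swap (0 : Fin 3) 1) = ![y, x, z] := by
    ext i; fin_cases i <;> rfl
  rwa [e] at h

theorem ApproxSymmetric.swap_fst_trd (hsymm : ApproxSymmetric ε₂ f) {x y z : ℝ} (hx : 0 ≤ x)
    (hy : 0 ≤ y) (hz : 0 ≤ z) : |f ![x, y, z] - f ![z, y, x]| ≤ ε₂ := by
  have h := hsymm ![x, y, z] (by intro i; fin_cases i <;> simpa) (Equiv.swap 0 2)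
  have e : ![x, y, z] ∘ (Equiv.swap (0 : Fin 3) 2) = ![z, y, x] := by
    ext i; fin_cases i <;> rfl
  rwa [e] at h

theorem ApproxSymmetric.swap_snd_trd (hsymm : ApproxSymmetric ε₂ f) {x y z : ℝ} (hx : 0 ≤ x)
    (hy : 0 ≤ y) (hz : 0 ≤ z) : |f ![x, y, z] - f ![x, z, y]| ≤ ε₂ := by
  have h := hsymm ![x, y, z] (by intro i; fin_cases i <;> simpa) (Equiv.swap 1 2)
  have e : ![x, y, z] ∘ (Equiv.swap (1 : Fin 3) 2) = ![x, z, y] := by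
    ext i; fin_cases i <;> rfl
  rwa [e] at h

theorem abs_edgeExt_comm_sub_le (hf : ApproxModifiedEntropy α ε₁ f)
    (hsymm : ApproxSymmetric ε₂ f) {y z : ℝ} (hy : 0 < y) (hz : 0 < z) :
    |edgeExt α f y z - edgeExt α f z y| ≤ 2 * ε₁ + ε₂ := by
  have h1 : |_ - _ - edgeExt α f y z| ≤ _ := hf 1 y z one_pos hy hz
  have h2 : |_ - _ - edgeExt α f z y| ≤ _ := hf 1 z y one_pos hz hy
  have h3 := hsymm.swap_snd_trd zero_le_one hy.le hz.le
  rw [add_comm z y] at h2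
  rw [abs_le] at *
  constructor <;> linarith

/-- The two sums approximate `f` at `(x, y, z)` and `(y, x, z)`. -/
theorem abs_exchange_sub_le (hf : ApproxModifiedEntropy α ε₁ f)
    (hsymm : ApproxSymmetric ε₂ f) {x y z : ℝ} (hx : 0 < x) (hy : 0 < y) (hz : 0 < z) :
    |(f ![x, y + z, 0] + edgeExt α f y z) - (f ![y, x + z, 0] + edgeExt α f x z)|
      ≤ 2 * ε₁ + ε₂ := by
  have h1 : |_ - _ - edgeExt α f y z| ≤ _ := hf x y z hx hy hz
  have h2 : |_ - _ - edgeExt α f x z| ≤ _ := hf y x z hy hx hz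
  have h3 := hsymm.swap_fst_snd hx.le hy.le hz.le
  rw [abs_le] at *
  constructor <;> linarith

/-- `edgeExt α f` is approximately a `2`-cocycle on the positive reals. -/
theorem abs_edgeExt_cocycle_le (hf : ApproxModifiedEntropy α ε₁ f)
    (hsymm : ApproxSymmetric ε₂ f) {p q r : ℝ} (hp : 0 < p) (hq : 0 < q) (hr : 0 < r) :
    |(edgeExt α f p q + edgeExt α f (p + q) r) - (edgeExt α f p r + edgeExt α f (p + r) q)|
      ≤ 4 * ε₁ + 3 * ε₂ := by
  -- The two exchanges share the value at `(p, p + q + r, 0)`, which cancels; their other values of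
  -- `f` differ by a swap.
  have h1 := abs_exchange_sub_le hf hsymm hp (add_pos hp hq) hr
  have h2 := abs_exchange_sub_le hf hsymm hp (add_pos hp hr) hq
  have h3 := hsymm.swap_fst_snd (add_pos hp hq).le (add_pos hp hr).le le_rfl
  rw [add_right_comm p r q] at h2
  rw [abs_le] at *
  constructor <;> linarith

/-- The consequence of the approximate cocycle property for the doubling map. -/
theorem abs_doubling_le (hf : ApproxModifiedEntropy α ε₁ f)
    (hsymm : ApproxSymmetric ε₂ f) {x y : ℝ} (hx : 0 < x) (hy : 0 < y) :
    |(2 ^ α - 2) * edgeExt α f x y + edgeExt α f 1 1 * (x ^ α + y ^ α - (x + y) ^ α)|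
      ≤ 18 * ε₁ + 12 * ε₂ := by
  have hxy := add_pos hx hy
  -- In the sum of the three instances the mixed terms cancel up to symmetry, at total cost 3(4ε₁ +
  -- 3ε₂) + 3(2ε₁ + ε₂).
  have h1 := abs_edgeExt_cocycle_le hf hsymm hy hy (by positivity : 0 < 2 * x)
  have h2 := abs_edgeExt_cocycle_le hf hsymm hx hx hy
  have h3 := abs_edgeExt_cocycle_le hf hsymm hx hxy hy
  have s1 := abs_edgeExt_comm_sub_le hf hsymm hy (by positivity : 0 < 2 * x)
  have s2 := abs_edgeExt_comm_sub_le hf hsymm hxy hx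
  have s3 := abs_edgeExt_comm_sub_le hf hsymm (by positivity : 0 < 2 * y)
    (by positivity : 0 < 2 * x)
  have e1 := edgeExt_mul α f two_pos hx hy
  have e2 := edgeExt_self α f hx
  have e3 := edgeExt_self α f hy
  have e4 := edgeExt_self α f hxy
  rw [show y + y = 2 * y by ring] at h1
  rw [show x + x = 2 * x by ring] at h2
  rw [show x + (x + y) = y + 2 * x by ring] at h3
  have e : (2 ^ α - 2) * edgeExt α f x y + edgeExt α f 1 1 * (x ^ α + y ^ α - (x + y) ^ α)
      = edgeExt α f (2 * x) (2 * y) + edgeExt α f x x + edgeExt α f y y - 2 * edgeExt α f x y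
        - edgeExt α f (x + y) (x + y) := by
    rw [e1, e2, e3, e4]; ring
  rw [e]
  clear e e1 e2 e3 e4
  rw [abs_le] at *
  constructor <;> linarith

/-- For `α ≠ 0, 1`, the function `edgeExt α f` is exactly a coboundary. -/
theorem exists_edgeExt_eq (hα₀ : α ≠ 0) (hα₁ : α ≠ 1) (hf : ApproxModifiedEntropy α ε₁ f)
    (hsymm : ApproxSymmetric ε₂ f) :
    ∃ a : ℝ, ∀ x y : ℝ, 0 < x → 0 < y →
      edgeExt α f x y = a * x ^ α + a * y ^ α - a * (x + y) ^ α := by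
  have h2 : (2 : ℝ) - 2 ^ α ≠ 0 := by
    intro h
    have h' : (2 : ℝ) ^ α = 2 ^ (1 : ℝ) := by rw [Real.rpow_one]; linarith
    exact hα₁ ((Real.rpow_right_inj two_pos (by norm_num)).1 h')
  refine ⟨edgeExt α f 1 1 / (2 - 2 ^ α), fun x y hx hy => ?_⟩
  have h0 := eq_zero_of_forall_abs_rpow_mul_le (C := 18 * ε₁ + 12 * ε₂) hα₀
    (D := (2 ^ α - 2) * edgeExt α f x y + edgeExt α f 1 1 * (x ^ α + y ^ α - (x + y) ^ α))
    (fun s hs => by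
      have h := abs_doubling_le hf hsymm (mul_pos hs hx) (mul_pos hs hy)
      rw [edgeExt_mul α f hs hx hy, ← mul_add, Real.mul_rpow hs.le hx.le,
        Real.mul_rpow hs.le hy.le, Real.mul_rpow hs.le (add_pos hx hy).le] at h
      refine le_trans (le_of_eq (congrArg _ ?_)) h
      ring)
  field_simp
  linarith

/-- If `edgeExt α f` is within `η` of a coboundary, then `f` is close to a sum of powers plus a
function of the sum of the variables. -/
theorem exists_abs_sub_le_of_edgeExt (hε₂ : 0 ≤ ε₂) (hf : ApproxModifiedEntropy α ε₁ f)
    (hsymm : ApproxSymmetric ε₂ f) {a η : ℝ}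
    (h : ∀ y z : ℝ, 0 < y → 0 < z →
      |edgeExt α f y z - (a * y ^ α + a * z ^ α - a * (y + z) ^ α)| ≤ η) :
    ∃ φ : ℝ → ℝ, ∀ x y z : ℝ, 0 < x → 0 < y → 0 < z →
      |f ![x, y, z] - (a * x ^ α + a * y ^ α + a * z ^ α + φ (x + y + z))|
        ≤ 2 * (ε₁ + η) + 3 / 2 * ε₂ := by
  let E : ℝ → ℝ → ℝ → ℝ := fun x y z => f ![x, y, z] - (a * x ^ α + a * y ^ α + a * z ^ α)
  have hE : ∀ x y z y' z' : ℝ, 0 < x → 0 < y → 0 < z → 0 < y' → 0 < z' → y + z = y' + z' →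
      |E x y z - E x y' z'| ≤ 2 * (ε₁ + η) := by
    intro x y z y' z' hx hy hz hy' hz' hs
    have h1 : |_ - _ - edgeExt α f y z| ≤ _ := hf x y z hx hy hz
    have h2 : |_ - _ - edgeExt α f y' z'| ≤ _ := hf x y' z' hx hy' hz'
    have h3 := h y z hy hz
    have h4 := h y' z' hy' hz'
    rw [← hs] at h2 h4
    simp only [E]
    rw [abs_le] at *
    constructor <;> linarith
  have hmin : ∀ x y z : ℝ, 0 < x → 0 < y → 0 < z → ∃ u v w : ℝ, 0 < u ∧ 0 < v ∧ 0 < w ∧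
      u + v + w = x + y + z ∧ 3 * u ≤ x + y + z ∧ |E x y z - E u v w| ≤ ε₂ := by
    intro x y z hx hy hz
    by_cases h1 : 3 * x ≤ x + y + z
    · exact ⟨x, y, z, hx, hy, hz, rfl, h1, by simpa using hε₂⟩
    by_cases h2 : 3 * y ≤ x + y + z
    · refine ⟨y, x, z, hy, hx, hz, by ring, h2, ?_⟩
      refine le_trans (le_of_eq (congrArg _ ?_)) (hsymm.swap_fst_snd hx.le hy.le hz.le)
      simp only [E]; ring
    · refine ⟨z, y, x, hz, hy, hx, by ring, by linarith, ?_⟩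
      refine le_trans (le_of_eq (congrArg _ ?_)) (hsymm.swap_fst_trd hx.le hy.le hz.le)
      simp only [E]; ring
  have hdiam : ∀ x y z x' y' z' : ℝ, 0 < x → 0 < y → 0 < z → 0 < x' → 0 < y' → 0 < z' →
      x + y + z = x' + y' + z' →
      E x y z - E x' y' z' ≤ 2 * (2 * (ε₁ + η) + 3 / 2 * ε₂) := by
    intro x y z x' y' z' hx hy hz hx' hy' hz' hs
    obtain ⟨u, v, w, hu, hv, hw, hsum, hle, h1⟩ := hmin x y z hx hy hz
    obtain ⟨u', v', w', hu', hv', hw', hsum', hle', h2⟩ := hmin x' y' z' hx' hy' hz'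
    -- Both first coordinates are at most a third of the total, so some triple contains both. It
    -- links the two given triples through two moves `hE` and three swaps.
    have hr : 0 < x + y + z - u - u' := by linarith
    have h3 := hE u v w u' (x + y + z - u - u') hu hv hw hu' hr (by linarith)
    have h4 := hE u' v' w' u (x + y + z - u - u') hu' hv' hw' hu hr (by linarith)
    have h5 : |E u u' (x + y + z - u - u') - E u' u (x + y + z - u - u')| ≤ ε₂ := by
      refine le_trans (le_of_eq (congrArg _ ?_)) (hsymm.swap_fst_snd hu.le hu'.le hr.le)
      simp only [E]; ring
    rw [abs_le] at *
    linarith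
  have hcenter : ∀ t : ℝ, ∃ m : ℝ, ∀ x y z : ℝ, 0 < x → 0 < y → 0 < z → x + y + z = t →
      |E x y z - m| ≤ 2 * (ε₁ + η) + 3 / 2 * ε₂ := by
    intro t
    obtain ⟨m, hm⟩ := exists_center_of_sub_le
      (S := {s | ∃ x y z : ℝ, 0 < x ∧ 0 < y ∧ 0 < z ∧ x + y + z = t ∧ s = E x y z})
      (M := 2 * (ε₁ + η) + 3 / 2 * ε₂) (by
        rintro _ ⟨x, y, z, hx, hy, hz, ht, rfl⟩ _ ⟨x', y', z', hx', hy', hz', ht', rfl⟩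
        exact hdiam x y z x' y' z' hx hy hz hx' hy' hz' (ht.trans ht'.symm))
    exact ⟨m, fun x y z hx hy hz ht => hm _ ⟨x, y, z, hx, hy, hz, ht, rfl⟩⟩
  choose φ hφ using hcenter
  refine ⟨φ, fun x y z hx hy hz => ?_⟩
  rw [← sub_sub]
  exact hφ _ x y z hx hy hz rfl

theorem exists_abs_sub_le_of_ne_zero (hα₀ : α ≠ 0) (hα₁ : α ≠ 1) (hε₂ : 0 ≤ ε₂)
    (hf : ApproxModifiedEntropy α ε₁ f) (hsymm : ApproxSymmetric ε₂ f) :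
    ∃ (a : ℝ) (φ : ℝ → ℝ), ∀ x y z : ℝ, 0 < x → 0 < y → 0 < z →
      |f ![x, y, z] - (a * x ^ α + a * y ^ α + a * z ^ α + φ (x + y + z))|
        ≤ 2 * ε₁ + 3 / 2 * ε₂ := by
  obtain ⟨a, ha⟩ := exists_edgeExt_eq hα₀ hα₁ hf hsymm
  obtain ⟨φ, hφ⟩ := exists_abs_sub_le_of_edgeExt (a := a) (η := 0) hε₂ hf hsymm
    (fun y z hy hz => by rw [ha y z hy hz, sub_self, abs_zero])
  exact ⟨a, φ, by simpa using hφ⟩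

theorem exists_abs_sub_le_of_eq_zero (hε₂ : 0 ≤ ε₂)
    (hf : ApproxModifiedEntropy 0 ε₁ f) (hsymm : ApproxSymmetric ε₂ f) :
    ∃ φ : ℝ → ℝ, ∀ x y z : ℝ, 0 < x → 0 < y → 0 < z →
      |f ![x, y, z] - φ (x + y + z)| ≤ 38 * ε₁ + 51 / 2 * ε₂ := by
  -- Here 2^α - 2 = -1, so the doubling bound is itself the distance from G to G(1,1).
  obtain ⟨φ, hφ⟩ := exists_abs_sub_le_of_edgeExt (a := edgeExt 0 f 1 1)
    (η := 18 * ε₁ + 12 * ε₂) hε₂ hf hsymm (fun y z hy hz => by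
      have h := abs_doubling_le hf hsymm hy hz
      simp only [Real.rpow_zero] at h ⊢
      rw [abs_le] at *
      constructor <;> linarith)
  refine ⟨fun t => 3 * edgeExt 0 f 1 1 + φ t, fun x y z hx hy hz => ?_⟩
  have h := hφ x y z hx hy hz
  simp only [Real.rpow_zero] at h
  rw [abs_le] at *
  constructor <;> linarith

end

end ModifiedEntropy

theorem theorem3p1 (α ε₁ ε₂ : ℝ) (hα : α ≠ 1) (hε₁ : 0 ≤ ε₁) (hε₂ : 0 ≤ ε₂)
    (f : (Fin 3 → ℝ) → ℝ)
    (hf : ModifiedEntropy.ApproxModifiedEntropy α ε₁ f)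
    (hsymm : ModifiedEntropy.ApproxSymmetric ε₂ f) :
    (α < 0 → ∃ (a : ℝ) (φ₁ : ℝ → ℝ), ∀ x y z : ℝ, 0 < x → 0 < y → 0 < z →
      |f ![x, y, z] - (a * x ^ α + a * y ^ α + a * z ^ α + φ₁ (x + y + z))|
        ≤ 2 * ε₁ + 3 * ε₂) ∧
    (α = 0 → ∃ φ₂ : ℝ → ℝ, ∀ x y z : ℝ, 0 < x → 0 < y → 0 < z →
      |f ![x, y, z] - φ₂ (x + y + z)| ≤ 191 * ε₁ + 1263 * ε₂) ∧
    (0 < α → ∃ a : ℝ, ∀ n : ℕ, 1 ≤ n → ∃ ψ : ℝ → ℝ,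
      ∀ x ∈ Set.Ioc (0 : ℝ) n, ∀ y ∈ Set.Ioc (0 : ℝ) n, ∀ z ∈ Set.Ioc (0 : ℝ) n,
        |f ![x, y, z] - (a * x ^ α + a * y ^ α + a * z ^ α + ψ (x + y + z))|
          ≤ ModifiedEntropy.c n α * ε₁ + ModifiedEntropy.d n α * ε₂) := by

  refine ⟨fun h => ?_, fun h => ?_, fun h => ?_⟩
  · obtain ⟨a, φ, hφ⟩ :=
      ModifiedEntropy.exists_abs_sub_le_of_ne_zero h.ne hα hε₂ hf hsymm
    exact ⟨a, φ, fun x y z hx hy hz => (hφ x y z hx hy hz).trans (by linarith)⟩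
  · subst h
    obtain ⟨φ, hφ⟩ := ModifiedEntropy.exists_abs_sub_le_of_eq_zero hε₂ hf hsymm
    exact ⟨φ, fun x y z hx hy hz => (hφ x y z hx hy hz).trans (by linarith)⟩
  · obtain ⟨a, φ, hφ⟩ :=
      ModifiedEntropy.exists_abs_sub_le_of_ne_zero h.ne' hα hε₂ hf hsymm
    -- One `φ` serves every `n`, since its error bound is uniform on all positive triples.
    refine ⟨a, fun n _ => ⟨φ, fun x hx y hy z hz => (hφ x y z hx.1 hy.1 hz.1).trans ?_⟩⟩
    have h1 := mul_le_mul_of_nonneg_right (ModifiedEntropy.two_le_c n α) hε₁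
    have h2 := mul_le_mul_of_nonneg_right (ModifiedEntropy.four_le_d n α) hε₂
    linarith
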